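/- Throughout, $\hat f(\xi)=\int_{\mathbb R^d}e^{-2\pi i\langle\xi,x\rangle}f(x)\,dx$, and $p'$, $r'\in[1,\infty]$ denote the Hölder conjugate exponents of $p$, $r$ (so $1/p+1/p'=1$ and $1/r+1/r'=1$). Theorem. Let $\mu$ be a Borel probability measure on $\mathbb R^d$, let $n\ge 1$ be an integer and let $1\le r\le\infty$. Assume that the $n$-fold convolution $\mu^{*n}=\mu*\cdots*\mu$ is absolutely continuous with respect to Lebesgue measure with a density in $L^r(\mathbb R^d)$. Let $$1\le p\le \frac{2n}{2n-1}\ \text{ if } r\ge 2,\qquad 1\le p\le \frac{nr'}{nr'-1}\ \text{ if } 1\le r\le 2,$$ and let $1\le q\le \dfrac{p'}{nr'}$. Then there is a constant $C>0$, independent of $f$, such that $$\|\hat f\|_{L^q(\mu)}\le C\,\|f\|_{L^p(\mathbb R^d)}\qquad\text{for all Schwartz functions } f\in\mathcal S(\mathbb R^d).$$ Here $\frac{nr'}{nr'-1}$ is read as $1$ when $r'=\infty$, and $\frac{p'}{nr'}$ is read as $\infty$ when $p'=\infty$ (that is, when $p=1$), including the case $p'=r'=\infty$; in particular, $q=\infty$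 is allowed when $p=1$. -/

import Mathlib

open MeasureTheory
open scoped ENNReal NNReal SchwartzMap FourierTransform

/-- The `n`-fold convolution `μ * ⋯ * μ` of a measure with itself (`n` factors); the empty
convolution is the Dirac mass at `0`, so that the power with `n = 1` is `μ`. -/
noncomputable def convPow {E : Type*} [AddMonoid E] [MeasurableSpace E] (μ : Measure E) :
    ℕ → Measure E
  | 0 => Measure.dirac 0
  | n + 1 => (convPow μ n).conv μ

/-- The measure `ν` belongs to `L^r`: it is given by a nonnegative density with respect to
Lebesgue measure, and this density is in `L^r`. -/
def MeasureMemLp {E : Type*} [MeasureSpace E] (ν : Measure E) (r : ℝ≥0∞) : Prop :=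
  ∃ g : E → ℝ, (∀ x, 0 ≤ g x) ∧ MemLp g r volume ∧
    ν = volume.withDensity (fun x => ENNReal.ofReal (g x))

/-- The quantity `a / (a - 1)`, for `1 < a ≤ ∞`, with its limit value `1` at `a = ∞`. -/
noncomputable def ratioPred (a : ℝ≥0∞) : ℝ≥0∞ := if a = ∞ then 1 else a / (a - 1)

/-! The proof is by duality, from an estimate for the extension operator `g ↦ (g μ)^`.

Put `s = p' / n`, so that `2 ≤ s < ∞` (the case `p = 1` is trivial). The `n`-th power of the Fourier
transform of `g μ` is the Fourier transform of the convolution power `(g μ) * ⋯ * (g μ)`. The latter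
has a density `φ` with respect to `convPow μ n = h dx`, a conditional mean of `∏ g(ξᵢ)` given
`∑ ξᵢ` (`exists_condMean`), so it is the function `h φ`. By Hausdorff–Young
(`exists_lintegral_fourier_rpow_le`) the norm of `(g μ)^` in `L^{p'}` is the `n`-th root of the
`L^s` norm of `(h φ)^`, and bounded by the `n`-th root of the `L^{s'}` norm of `h φ`.

If `q = p' / (n r')` and `g` has norm `K` in the dual of `L^q(μ)`, then `φ` has norm at most `K ^ n`
in the dual of `L^q(h dx)` (`exists_convPow_multiplier`, by induction on `n`). Since `h` is in `L^r`
and `s = r' q`, testing `φ` against `‖h φ‖ ^ (s' - 1)` and Hölder's inequality give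
`‖h φ‖_{s'} ≤ K ^ n ‖h‖_r ^ (1 / q)` (`lintegral_density_rpow_le`). Working with the dual norms
covers `q = 1` and `r = ∞` along with the other exponents.

Hausdorff–Young is needed only up to a constant, and is obtained by real interpolation between the
trivial `L¹` bound and Plancherel, with a truncation of the function at a height that depends on
the level (`meas_lt_norm_fourier_le`).
-/

/-! ### The Hausdorff–Young inequality -/

section HausdorffYoung

variable {E : Type*} [NormedAddCommGroup E] [InnerProductSpace ℝ E] [FiniteDimensional ℝ E]
  [MeasurableSpace E] [BorelSpace E]

theorem continuous_fourier_of_integrable {G : E → ℂ} (hG : Integrable G) : Continuous (𝓕 G) :=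
  VectorFourier.fourierIntegral_continuous Real.continuous_fourierChar
    (by exact continuous_inner) hG

theorem enorm_fourier_le (G : E → ℂ) (ξ : E) : ‖𝓕 G ξ‖ₑ ≤ ∫⁻ x, ‖G x‖ₑ := by
  rw [Real.fourier_eq]
  refine (enorm_integral_le_lintegral_enorm _).trans (lintegral_mono fun x => ?_)
  rw [← ofReal_norm, Circle.norm_smul, ofReal_norm]

open scoped ContDiff in
/-- Plancherel for the Fourier integral on `L¹ ∩ L²`: it is almost everywhere equal to the
`L²`-Fourier transform, as both define the same tempered distribution. -/
theorem eLpNorm_two_fourier {G : E → ℂ} (hG : Integrable G) (hG2 : MemLp G 2) :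
    eLpNorm (𝓕 G) 2 = eLpNorm G 2 := by
  obtain ⟨H, hH⟩ : ∃ H : Lp (α := E) ℂ 2, H = 𝓕 (hG2.toLp G) := ⟨_, rfl⟩
  have key : ∀ᵐ x, H x = 𝓕 G x := by
    refine ae_eq_of_integral_contDiff_smul_eq (μ := volume) ?_ ?_ ?_
    · exact (Lp.memLp H).locallyIntegrable (by norm_num)
    · exact (continuous_fourier_of_integrable hG).locallyIntegrable (μ := volume)
    · intro g hg hgs
      have hg1 : HasCompactSupport (Complex.ofRealCLM ∘ g) := hgs.comp_left rfl
      have hg2 : ContDiff ℝ ∞ (Complex.ofRealCLM ∘ g) := by fun_prop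
      obtain ⟨φ, hφ⟩ : ∃ φ : 𝓢(E, ℂ), ∀ x, φ x = g x := ⟨hg1.toSchwartzMap hg2, fun x => rfl⟩
      have e1 := congrArg (fun T => T φ) (Lp.fourier_toTemperedDistribution_eq (hG2.toLp G))
      simp only [TemperedDistribution.fourier_apply, Lp.toTemperedDistribution_apply] at e1
      have e2 : ∫ x, (𝓕 φ) x • (hG2.toLp G) x = ∫ x, 𝓕 (φ : E → ℂ) x • G x := by
        refine integral_congr_ae ?_
        filter_upwards [hG2.coeFn_toLp] with x hx
        rw [hx, SchwartzMap.fourier_coe]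
      have e3 : ∫ x, 𝓕 (φ : E → ℂ) x • G x = ∫ x, φ x • 𝓕 G x := by
        simpa using! (VectorFourier.integral_fourierIntegral_smul_eq_flip (L := innerₗ E)
          Real.continuous_fourierChar continuous_inner φ.integrable hG)
      have e4 : ∀ F : E → ℂ, ∫ x, g x • F x = ∫ x, φ x • F x := fun F => by
        refine integral_congr_ae (Filter.Eventually.of_forall fun x => ?_)
        simp [hφ]
      rw [e4, e4, ← e3, ← e2, e1, ← hH]
  rw [← eLpNorm_congr_ae key, ← Lp.enorm_def, ← eLpNorm_congr_ae hG2.coeFn_toLp, ← Lp.enorm_def, hH,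
    enorm_eq_nnnorm, enorm_eq_nnnorm]
  congr 1
  exact NNReal.eq (Lp.norm_fourier_eq _)

theorem lintegral_fourier_sq {G : E → ℂ} (hG : Integrable G) (hG2 : MemLp G 2) :
    ∫⁻ ξ, ‖𝓕 G ξ‖ₑ ^ 2 = ∫⁻ x, ‖G x‖ₑ ^ 2 := by
  have h := eLpNorm_two_fourier hG hG2
  rw [eLpNorm_eq_lintegral_rpow_enorm_toReal (by norm_num) (by norm_num),
    eLpNorm_eq_lintegral_rpow_enorm_toReal (by norm_num) (by norm_num)] at h
  have := ENNReal.rpow_left_injective (x := 1 / (2 : ℝ≥0∞).toReal) (by norm_num) h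
  simpa using this

/-- The level set estimate behind Hausdorff–Young. At level `t`, the function `G` is cut where
`t ‖G‖ ^ (a - 1) = 2`; the normalization `∫ ‖G‖ ^ a ≤ 1` makes the `L¹` norm of the large part at
most `t / 2`, and the small part is controlled by Chebyshev and Plancherel. -/
theorem meas_lt_norm_fourier_le {G : E → ℂ} (hGm : Measurable G) (hG : Integrable G) {a : ℝ}
    (ha : 1 < a) (hB : ∫⁻ x, ‖G x‖ₑ ^ a ≤ 1) {t : ℝ} (ht : 0 < t) :
    volume {ξ | t < ‖𝓕 G ξ‖} ≤ ENNReal.ofReal (4 / t ^ 2) *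
      ∫⁻ x, {x | t * ‖G x‖ ^ (a - 1) ≤ 2}.indicator (fun x => ‖G x‖ₑ ^ 2) x := by
  set S : Set E := {x | t * ‖G x‖ ^ (a - 1) ≤ 2} with hS
  have hSm : MeasurableSet S := by
    refine measurableSet_le ?_ measurable_const
    fun_prop
  set G₁ := S.indicator G with hG₁
  set G₂ := Sᶜ.indicator G with hG₂
  have hG₁i : Integrable G₁ := hG.indicator hSm
  have hG₂i : Integrable G₂ := hG.indicator hSm.compl
  have hsum : G = G₁ + G₂ := (Set.indicator_self_add_compl S G).symm
  have hF : ∀ ξ, 𝓕 G ξ = 𝓕 G₁ ξ + 𝓕 G₂ ξ := by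
    intro ξ
    conv_lhs => rw [hsum]
    exact (congrFun (VectorFourier.fourierIntegral_add (L := innerₗ E) Real.continuous_fourierChar
      continuous_inner hG₁i hG₂i) ξ)
  -- on the large part, `‖G‖ ≤ (t / 2) ‖G‖ ^ a`
  have hL : ∫⁻ x, ‖G₂ x‖ₑ ≤ ENNReal.ofReal (t / 2) := by
    calc ∫⁻ x, ‖G₂ x‖ₑ ≤ ∫⁻ x, ENNReal.ofReal (t / 2) * ‖G x‖ₑ ^ a := by
          refine lintegral_mono fun x => ?_
          by_cases hx : x ∈ S
          · simp [hG₂, hx]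
          · have hx' : 2 < t * ‖G x‖ ^ (a - 1) := by simpa [hS] using hx
            have : ‖G x‖ ≤ t / 2 * ‖G x‖ ^ a := by
              have h1 : ‖G x‖ ^ a = ‖G x‖ ^ (a - 1) * ‖G x‖ := by
                rcases eq_or_lt_of_le (norm_nonneg (G x)) with h0 | h0
                · rw [← h0]; simp [Real.zero_rpow (by linarith : a ≠ 0)]
                · conv_lhs => rw [show a = a - 1 + 1 by ring]
                  rw [Real.rpow_add h0, Real.rpow_one]
              rw [h1]
              nlinarith [norm_nonneg (G x)]
            simp only [hG₂, Set.indicator_of_mem (show x ∈ Sᶜ from hx)]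
            rw [← ofReal_norm, ENNReal.ofReal_rpow_of_nonneg (norm_nonneg _) (by linarith),
              ← ENNReal.ofReal_mul (by positivity)]
            exact ENNReal.ofReal_le_ofReal this
      _ = ENNReal.ofReal (t / 2) * ∫⁻ x, ‖G x‖ₑ ^ a := by
          rw [lintegral_const_mul' _ _ ENNReal.ofReal_ne_top]
      _ ≤ ENNReal.ofReal (t / 2) := by
          calc _ ≤ ENNReal.ofReal (t / 2) * 1 := by gcongr
            _ = _ := mul_one _
  have hG₁2 : MemLp G₁ 2 := by
    have hb : ∀ x, ‖G₁ x‖ ≤ (2 / t) ^ (a - 1)⁻¹ := by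
      intro x
      by_cases hx : x ∈ S
      · simp only [hG₁, Set.indicator_of_mem hx]
        have h2 : ‖G x‖ ^ (a - 1) ≤ 2 / t := by
          rw [le_div_iff₀ ht, mul_comm]; exact hx
        calc ‖G x‖ = (‖G x‖ ^ (a - 1)) ^ (a - 1)⁻¹ := by
              rw [← Real.rpow_mul (norm_nonneg _), mul_inv_cancel₀ (by linarith), Real.rpow_one]
          _ ≤ _ := Real.rpow_le_rpow (by positivity) h2 (inv_nonneg.2 (by linarith))
      · simp only [hG₁, Set.indicator_of_notMem hx, norm_zero]
        positivity
    rw [memLp_two_iff_integrable_sq_norm hG₁i.aestronglyMeasurable]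
    refine (hG₁i.norm.const_mul ((2 / t) ^ (a - 1)⁻¹)).mono' ?_ ?_
    · exact (hG₁i.aestronglyMeasurable.norm.pow 2)
    · refine Filter.Eventually.of_forall fun x => ?_
      rw [Real.norm_of_nonneg (by positivity), sq]
      exact mul_le_mul_of_nonneg_right (hb x) (norm_nonneg _)
  have hsub : {ξ | t < ‖𝓕 G ξ‖} ⊆ {ξ | ENNReal.ofReal (t ^ 2 / 4) ≤ ‖𝓕 G₁ ξ‖ₑ ^ 2} := by
    intro ξ hξ
    have h2 : ‖𝓕 G₂ ξ‖ ≤ t / 2 := by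
      have := (enorm_fourier_le G₂ ξ).trans hL
      rw [← ofReal_norm] at this
      exact (ENNReal.ofReal_le_ofReal_iff (by positivity)).1 this
    have h1 : t / 2 ≤ ‖𝓕 G₁ ξ‖ := by
      have h3 := norm_add_le (𝓕 G₁ ξ) (𝓕 G₂ ξ)
      rw [← hF] at h3
      have h4 : t < ‖𝓕 G ξ‖ := hξ
      linarith
    show ENNReal.ofReal (t ^ 2 / 4) ≤ ‖𝓕 G₁ ξ‖ₑ ^ 2
    rw [← ofReal_norm, ← ENNReal.ofReal_pow (norm_nonneg _)]
    refine ENNReal.ofReal_le_ofReal ?_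
    nlinarith
  calc volume {ξ | t < ‖𝓕 G ξ‖} ≤ volume {ξ | ENNReal.ofReal (t ^ 2 / 4) ≤ ‖𝓕 G₁ ξ‖ₑ ^ 2} :=
        measure_mono hsub
    _ ≤ (∫⁻ ξ, ‖𝓕 G₁ ξ‖ₑ ^ 2) / ENNReal.ofReal (t ^ 2 / 4) := by
        refine meas_ge_le_lintegral_div ?_ ?_ ENNReal.ofReal_ne_top
        · have := (continuous_fourier_of_integrable hG₁i).measurable
          fun_prop
        · rw [Ne, ENNReal.ofReal_eq_zero, not_le]; positivity
    _ = ENNReal.ofReal (4 / t ^ 2) * ∫⁻ x, ‖G₁ x‖ₑ ^ 2 := by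
        rw [lintegral_fourier_sq hG₁i hG₁2, ENNReal.div_eq_inv_mul,
          ← ENNReal.ofReal_inv_of_pos (by positivity), inv_div]
    _ = _ := by
        congr 1
        refine lintegral_congr fun x => ?_
        by_cases hx : x ∈ S <;> simp [hG₁, hx]

/-- The integral over the levels `t` of the bound in `meas_lt_norm_fourier_le`, at one point `x`
with `z = G x`. -/
theorem lintegral_Ioi_truncation_le {s a : ℝ} (hs : 2 < s) (ha : (a - 1) * (s - 1) = 1) (z : ℂ) :
    ∫⁻ t in Set.Ioi (0 : ℝ), ENNReal.ofReal (4 / t ^ 2) *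
      {t : ℝ | t * ‖z‖ ^ (a - 1) ≤ 2}.indicator (fun _ => ‖z‖ₑ ^ 2) t *
        ENNReal.ofReal (t ^ (s - 1)) ≤
      ENNReal.ofReal (4 * 2 ^ (s - 2) / (s - 2)) * ‖z‖ₑ ^ a := by
  have ha1 : 0 < a - 1 := by
    by_contra h
    nlinarith
  rcases eq_or_ne z 0 with rfl | hz
  · simp [Set.indicator]
  have hz0 : 0 < ‖z‖ := norm_pos_iff.2 hz
  set T : ℝ := 2 * ‖z‖ ^ (-(a - 1)) with hT
  have hTpos : 0 < T := by positivity
  have hle : ∀ t : ℝ, t * ‖z‖ ^ (a - 1) ≤ 2 ↔ t ≤ T := by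
    intro t
    rw [hT, Real.rpow_neg hz0.le, ← div_eq_mul_inv, le_div_iff₀ (by positivity)]
  calc _ = ∫⁻ t in Set.Ioi (0 : ℝ), (Set.Ioc 0 T).indicator
          (fun t => ENNReal.ofReal (4 * ‖z‖ ^ 2 * t ^ (s - 3))) t := by
        refine setLIntegral_congr_fun measurableSet_Ioi fun t ht => ?_
        have ht : 0 < t := ht
        by_cases h : t ≤ T
        · simp only [Set.indicator, Set.mem_ofPred_eq, hle, Set.mem_Ioc, h, ht, and_self, if_true]
          rw [← ofReal_norm, ← ENNReal.ofReal_pow hz0.le,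
            ← ENNReal.ofReal_mul (by positivity), ← ENNReal.ofReal_mul (by positivity)]
          congr 1
          rw [show s - 1 = s - 3 + 2 by ring, Real.rpow_add ht, Real.rpow_two]
          field_simp
        · simp [Set.indicator, hle, h]
    _ = ∫⁻ t in Set.Ioc 0 T, ENNReal.ofReal (4 * ‖z‖ ^ 2 * t ^ (s - 3)) := by
        rw [lintegral_indicator measurableSet_Ioc, Measure.restrict_restrict measurableSet_Ioc]
        congr 2
        ext t; simp +contextual
    _ = ENNReal.ofReal (∫ t in Set.Ioc 0 T, 4 * ‖z‖ ^ 2 * t ^ (s - 3)) := by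
        rw [ofReal_integral_eq_lintegral_ofReal]
        · have := (intervalIntegral.intervalIntegrable_rpow' (a := 0) (b := T)
            (by linarith : -1 < s - 3)).const_mul (4 * ‖z‖ ^ 2)
          rwa [intervalIntegrable_iff_integrableOn_Ioc_of_le hTpos.le] at this
        · refine (ae_restrict_iff' measurableSet_Ioc).2 (Filter.Eventually.of_forall fun t ht => ?_)
          have := ht.1
          simp only [Pi.zero_apply]
          positivity
    _ = ENNReal.ofReal (4 * 2 ^ (s - 2) / (s - 2) * ‖z‖ ^ a) := by
        congr 1
        rw [← intervalIntegral.integral_of_le hTpos.le, intervalIntegral.integral_const_mul,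
          integral_rpow (Or.inl (by linarith)), show s - 3 + 1 = s - 2 by ring,
          Real.zero_rpow (by linarith), sub_zero, hT, Real.mul_rpow (by norm_num) (by positivity),
          ← Real.rpow_mul hz0.le]
        have : ‖z‖ ^ a = ‖z‖ ^ 2 * ‖z‖ ^ (-(a - 1) * (s - 2)) := by
          rw [← Real.rpow_two, ← Real.rpow_add hz0]
          congr 1
          nlinarith
        rw [this]; ring
    _ ≤ _ := by
        rw [ENNReal.ofReal_mul (div_nonneg (by positivity) (by linarith)), ← ofReal_norm,
          ENNReal.ofReal_rpow_of_nonneg hz0.le (by linarith)]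

theorem lintegral_fourier_rpow_le_of_le_one {s a : ℝ} (hs : 2 < s) (ha : (a - 1) * (s - 1) = 1)
    {G : E → ℂ} (hGm : Measurable G) (hG : Integrable G) (hB : ∫⁻ x, ‖G x‖ₑ ^ a ≤ 1) :
    ∫⁻ ξ, ‖𝓕 G ξ‖ₑ ^ s ≤ ENNReal.ofReal s * ENNReal.ofReal (4 * 2 ^ (s - 2) / (s - 2)) := by
  have ha1 : 0 < a - 1 := by
    by_contra h
    nlinarith
  have hcont := continuous_fourier_of_integrable hG
  calc ∫⁻ ξ, ‖𝓕 G ξ‖ₑ ^ s = ∫⁻ ξ, ENNReal.ofReal (‖𝓕 G ξ‖ ^ s) := by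
        refine lintegral_congr fun ξ => ?_
        rw [← ofReal_norm, ENNReal.ofReal_rpow_of_nonneg (norm_nonneg _) (by linarith)]
    _ = ENNReal.ofReal s * ∫⁻ t in Set.Ioi 0,
          volume {ξ | t < ‖𝓕 G ξ‖} * ENNReal.ofReal (t ^ (s - 1)) :=
        lintegral_rpow_eq_lintegral_meas_lt_mul _
          (Filter.Eventually.of_forall fun _ => norm_nonneg _) hcont.norm.measurable.aemeasurable
          (by linarith)
    _ ≤ ENNReal.ofReal s * ∫⁻ t in Set.Ioi (0 : ℝ), ∫⁻ x, ENNReal.ofReal (4 / t ^ 2) *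
          {x | t * ‖G x‖ ^ (a - 1) ≤ 2}.indicator (fun x => ‖G x‖ₑ ^ 2) x *
            ENNReal.ofReal (t ^ (s - 1)) := by
        refine mul_le_mul' le_rfl ?_
        refine setLIntegral_mono' (measurableSet_Ioi (a := (0 : ℝ))) fun t ht => ?_
        rw [lintegral_mul_const' _ _ ENNReal.ofReal_ne_top,
          lintegral_const_mul' _ _ ENNReal.ofReal_ne_top]
        gcongr
        exact meas_lt_norm_fourier_le hGm hG (by linarith) hB ht
    _ = ENNReal.ofReal s * ∫⁻ x, ∫⁻ t in Set.Ioi (0 : ℝ), ENNReal.ofReal (4 / t ^ 2) *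
          {x | t * ‖G x‖ ^ (a - 1) ≤ 2}.indicator (fun x => ‖G x‖ₑ ^ 2) x *
            ENNReal.ofReal (t ^ (s - 1)) := by
        congr 1
        refine lintegral_lintegral_swap (Measurable.aemeasurable ?_)
        have hms : MeasurableSet {z : ℝ × E | z.1 * ‖G z.2‖ ^ (a - 1) ≤ 2} :=
          by
          refine measurableSet_le ?_ measurable_const
          fun_prop
        have h1 : Measurable fun z : ℝ × E =>
            {z : ℝ × E | z.1 * ‖G z.2‖ ^ (a - 1) ≤ 2}.indicator (fun z => ‖G z.2‖ₑ ^ 2) z :=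
          Measurable.indicator (by fun_prop) hms
        have h2 : Measurable fun z : ℝ × E => ENNReal.ofReal (4 / z.1 ^ 2) := by fun_prop
        have h3 : Measurable fun z : ℝ × E => ENNReal.ofReal (z.1 ^ (s - 1)) := by fun_prop
        exact (h2.mul h1).mul h3
    _ ≤ ENNReal.ofReal s * ∫⁻ x, ENNReal.ofReal (4 * 2 ^ (s - 2) / (s - 2)) * ‖G x‖ₑ ^ a := by
        gcongr with x
        exact lintegral_Ioi_truncation_le hs ha (G x)
    _ ≤ ENNReal.ofReal s * (ENNReal.ofReal (4 * 2 ^ (s - 2) / (s - 2)) * 1) := by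
        rw [lintegral_const_mul' _ _ ENNReal.ofReal_ne_top]
        gcongr
    _ = _ := by rw [mul_one]

/-- The Hausdorff–Young inequality `‖𝓕 G‖_s ≤ C ‖G‖_a`, for `2 ≤ s < ∞` and `1 / a + 1 / s = 1`
(written as `(a - 1) (s - 1) = 1`), with an unspecified constant. -/
theorem exists_lintegral_fourier_rpow_le {s a : ℝ} (hs : 2 ≤ s) (ha : (a - 1) * (s - 1) = 1) :
    ∃ C : ℝ≥0, 0 < C ∧ ∀ G : E → ℂ, Measurable G → Integrable G →
      ∫⁻ ξ, ‖𝓕 G ξ‖ₑ ^ s ≤ C * (∫⁻ x, ‖G x‖ₑ ^ a) ^ (s - 1) := by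
  rcases hs.eq_or_lt with rfl | hs
  · obtain rfl : a = 2 := by linarith
    refine ⟨1, one_pos, fun G hGm hG => ?_⟩
    norm_num
    by_cases h : MemLp G 2
    · exact (lintegral_fourier_sq hG h).le
    · have : ∫⁻ x, ‖G x‖ₑ ^ 2 = ∞ := by
        by_contra h'
        refine h ⟨hG.aestronglyMeasurable, ?_⟩
        rw [eLpNorm_lt_top_iff_lintegral_rpow_enorm_lt_top (by norm_num) (by norm_num)]
        simpa using lt_top_iff_ne_top.2 h'
      rw [this]; exact le_top
  have ha1 : 0 < a - 1 := by
    by_contra h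
    nlinarith
  set K : ℝ≥0 := Real.toNNReal s * Real.toNNReal (4 * 2 ^ (s - 2) / (s - 2)) with hK
  have hKpos : 0 < K := by
    refine mul_pos (Real.toNNReal_pos.2 (by linarith)) (Real.toNNReal_pos.2 ?_)
    exact div_pos (by positivity) (by linarith)
  refine ⟨K, hKpos, fun G hGm hG => ?_⟩
  set B := ∫⁻ x, ‖G x‖ₑ ^ a with hB
  rcases eq_or_ne B ∞ with hBt | hBt
  · rw [hBt, ENNReal.top_rpow_of_pos (by linarith), ENNReal.mul_top (by positivity)]
    exact le_top
  rcases eq_or_ne B 0 with hB0 | hB0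
  · have h0 : ∀ᵐ x, ‖G x‖ₑ = 0 := by
      rw [hB, lintegral_eq_zero_iff (by fun_prop)] at hB0
      filter_upwards [hB0] with x hx
      simpa [ENNReal.rpow_eq_zero_iff, (by linarith : 0 < a), (by linarith : ¬ a < 0)] using hx
    have h1 : ∀ ξ, ‖𝓕 G ξ‖ₑ = 0 := fun ξ => by
      refine le_antisymm ((enorm_fourier_le G ξ).trans ?_) bot_le
      rw [lintegral_congr_ae h0, lintegral_zero]
    simp [h1, (by linarith : 0 < s)]
  -- rescale so that the `L ^ a` norm is one
  set b : ℝ := B.toReal ^ (-(1 / a)) with hb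
  have hBpos : 0 < B.toReal := ENNReal.toReal_pos hB0 hBt
  have hbpos : 0 < b := by positivity
  have hba : ENNReal.ofReal b ^ a = B⁻¹ := by
    rw [ENNReal.ofReal_rpow_of_nonneg hbpos.le (by linarith), hb, ← Real.rpow_mul hBpos.le,
      show -(1 / a) * a = -1 by
        have : a ≠ 0 := by linarith
        field_simp, Real.rpow_neg_one, ENNReal.ofReal_inv_of_pos hBpos,
      ENNReal.ofReal_toReal hBt]
  have hbs : ENNReal.ofReal b ^ s = (B ^ (s - 1))⁻¹ := by
    have : s = a * (s - 1) := by nlinarith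
    conv_lhs => rw [this]
    rw [ENNReal.rpow_mul, hba, ENNReal.inv_rpow]
  have hnb : ‖(b : ℂ)‖ₑ = ENNReal.ofReal b := by
    rw [← ofReal_norm, Complex.norm_real, Real.norm_of_nonneg hbpos.le]
  have h1 := lintegral_fourier_rpow_le_of_le_one (E := E) hs ha (G := (b : ℂ) • G)
    (hGm.const_smul _) (hG.smul _) (by
      simp only [Pi.smul_apply, enorm_smul, ENNReal.mul_rpow_of_nonneg _ _ (by linarith : 0 ≤ a),
        hnb]
      rw [lintegral_const_mul _ (by fun_prop), hba, ENNReal.inv_mul_cancel hB0 hBt])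
  have h2 : 𝓕 ((b : ℂ) • G) = (b : ℂ) • 𝓕 G := by
    exact VectorFourier.fourierIntegral_const_smul _ _ _ _ _
  have hcont := continuous_fourier_of_integrable hG
  rw [h2] at h1
  simp only [Pi.smul_apply, enorm_smul, ENNReal.mul_rpow_of_nonneg _ _ (by linarith : 0 ≤ s),
        hnb] at h1
  rw [lintegral_const_mul _ (by fun_prop), hbs] at h1
  have h3 : (K : ℝ≥0∞) = ENNReal.ofReal s * ENNReal.ofReal (4 * 2 ^ (s - 2) / (s - 2)) := by
    rw [hK]; simp [ENNReal.ofReal]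
  rw [h3]
  rwa [ENNReal.inv_mul_le_iff, mul_comm] at h1
  · simp [hB0, hBt]
  · exact ENNReal.rpow_ne_top_of_nonneg (by linarith) hBt

end HausdorffYoung

/-! ### Densities of convolution powers -/

section Convolution

/-- The conditional mean of `F` given `S`, as a function `φ` on the target of `S`, obtained by
averaging `F` over the conditional distributions of `P` given `S`. -/
theorem exists_condMean {Ω E : Type*} [MeasurableSpace Ω] [StandardBorelSpace Ω] [Nonempty Ω]
    [MeasurableSpace E] (P : Measure Ω) [IsFiniteMeasure P] {S : Ω → E} (hS : Measurable S)
    {F : Ω → ℂ} (hF : Measurable F) {M : ℝ} (hM : ∀ ω, ‖F ω‖ ≤ M) :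
    ∃ φ : E → ℂ, Measurable φ ∧ (∀ y, ‖φ y‖ ≤ M) ∧
      (∀ u : E → ℂ, Measurable u → (∀ y, ‖u y‖ ≤ 1) →
        ∫ ω, u (S ω) * F ω ∂P = ∫ y, u y * φ y ∂(P.map S)) ∧
      ∀ u : E → ℝ≥0∞, Measurable u →
        ∫⁻ y, ‖φ y‖ₑ * u y ∂(P.map S) ≤ ∫⁻ ω, ‖F ω‖ₑ * u (S ω) ∂P := by
  set κ := ProbabilityTheory.condDistrib id S P with hκ
  have hmap : (P.map S).compProd κ = P.map fun ω => (S ω, ω) :=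
    ProbabilityTheory.compProd_map_condDistrib measurable_id.aemeasurable
  have hpair : Measurable fun ω => (S ω, ω) := hS.prodMk measurable_id
  refine ⟨fun y => ∫ ω, F ω ∂κ y, ?_, fun y => ?_, fun u hu hu1 => ?_, fun u hu => ?_⟩
  · exact (StronglyMeasurable.integral_kernel_prod_right' (κ := κ) (f := fun z : E × Ω => F z.2)
      (hF.comp measurable_snd).stronglyMeasurable).measurable
  · simpa using norm_integral_le_of_norm_le_const (μ := κ y) (Filter.Eventually.of_forall hM)
  · have hm : Measurable fun z : E × Ω => u z.1 * F z.2 := by fun_prop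
    calc ∫ ω, u (S ω) * F ω ∂P = ∫ z, u z.1 * F z.2 ∂(P.map fun ω => (S ω, ω)) := by
          rw [integral_map hpair.aemeasurable hm.aestronglyMeasurable]
      _ = ∫ y, ∫ ω, u y * F ω ∂κ y ∂(P.map S) := by
          rw [← hmap, Measure.integral_compProd]
          refine Integrable.of_bound (hm.aestronglyMeasurable) M
            (Filter.Eventually.of_forall fun z => ?_)
          rw [norm_mul]
          calc ‖u z.1‖ * ‖F z.2‖ ≤ 1 * M := by
                gcongr
                · exact hu1 _
                · exact hM _
            _ = M := one_mul M
      _ = _ := by simp_rw [integral_const_mul]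
  · calc ∫⁻ y, ‖∫ ω, F ω ∂κ y‖ₑ * u y ∂(P.map S)
        ≤ ∫⁻ y, ∫⁻ ω, ‖F ω‖ₑ * u y ∂κ y ∂(P.map S) := by
          refine lintegral_mono fun y => ?_
          rw [lintegral_mul_const _ hF.enorm]
          gcongr
          exact enorm_integral_le_lintegral_enorm _
      _ = ∫⁻ z, ‖F z.2‖ₑ * u z.1 ∂(P.map fun ω => (S ω, ω)) := by
          rw [← hmap, Measure.lintegral_compProd (by fun_prop)]
      _ = _ := by rw [lintegral_map (by fun_prop) hpair]

instance isProbabilityMeasure_convPow {E : Type*} [AddMonoid E] [MeasurableSpace E]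
    [MeasurableAdd₂ E] (μ : Measure E) [IsProbabilityMeasure μ] (n : ℕ) :
    IsProbabilityMeasure (convPow μ n) := by
  induction n with
  | zero => unfold convPow; infer_instance
  | succ n ih => unfold convPow; infer_instance

variable {E : Type*} [NormedAddCommGroup E] [InnerProductSpace ℝ E]
  [MeasurableSpace E] [BorelSpace E] [SecondCountableTopology E] [StandardBorelSpace E]

/-- The `n`-fold convolution power of the complex measure `g μ` has a bounded density `φ` with
respect to `convPow μ n`; this is expressed by the Fourier transform, which is the `n`-th power
of that of `g μ`. A bound `K` for `g` as a functional on `L^q(μ)` gives the bound `K ^ n` for `φ`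
as a functional on `L^q(convPow μ n)`. -/
theorem exists_convPow_multiplier (μ : Measure E) [IsProbabilityMeasure μ] {q : ℝ} (hq : 1 ≤ q)
    {g : E → ℂ} (hg : Measurable g) {M : ℝ} (hM : ∀ ξ, ‖g ξ‖ ≤ M) {K : ℝ≥0∞}
    (hK : ∀ v : E → ℝ≥0∞, Measurable v →
      ∫⁻ ξ, ‖g ξ‖ₑ * v ξ ∂μ ≤ K * (∫⁻ ξ, v ξ ^ q ∂μ) ^ (1 / q)) (n : ℕ) :
    ∃ φ : E → ℂ, Measurable φ ∧ (∀ y, ‖φ y‖ ≤ M ^ n) ∧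
      (∀ x, (∫ ξ, (Real.fourierChar (-inner ℝ ξ x) : ℂ) * g ξ ∂μ) ^ n =
        ∫ y, (Real.fourierChar (-inner ℝ y x) : ℂ) * φ y ∂(convPow μ n)) ∧
      ∀ u : E → ℝ≥0∞, Measurable u →
        ∫⁻ y, ‖φ y‖ₑ * u y ∂(convPow μ n) ≤
          K ^ n * (∫⁻ y, u y ^ q ∂(convPow μ n)) ^ (1 / q) := by
  have hq0 : 0 < q := by linarith
  induction n with
  | zero =>
    refine ⟨fun _ => 1, measurable_const, by simp, fun x => ?_, fun u hu => ?_⟩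
    · simp [convPow]
    · simp [convPow, lintegral_dirac' _ hu, lintegral_dirac' _ (hu.pow_const q),
        ENNReal.rpow_rpow_inv hq0.ne']
  | succ n ih =>
    obtain ⟨ψ, hψ, hψM, hψ1, hψ2⟩ := ih
    have hM0 : 0 ≤ M := (norm_nonneg _).trans (hM 0)
    have hadd : Measurable fun z : E × E => z.1 + z.2 := by fun_prop
    have hFm : Measurable fun z : E × E => ψ z.1 * g z.2 := by fun_prop
    obtain ⟨φ, hφ, hφM, hφ1, hφ2⟩ := exists_condMean ((convPow μ n).prod μ) hadd hFm
      (M := M ^ (n + 1)) (fun z => by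
        rw [norm_mul, pow_succ]
        exact mul_le_mul (hψM _) (hM _) (norm_nonneg _) (by positivity))
    refine ⟨φ, hφ, hφM, fun x => ?_, fun u hu => ?_⟩
    · have hcm : Measurable fun y : E => (Real.fourierChar (-inner ℝ y x) : ℂ) := by
        have : Continuous fun y : E => (Real.fourierChar (-inner ℝ y x) : ℂ) :=
          continuous_subtype_val.comp (Real.continuous_fourierChar.comp (by fun_prop))
        exact this.measurable
      have h := hφ1 (fun y => (Real.fourierChar (-inner ℝ y x) : ℂ)) hcm
        (fun y => (Circle.norm_coe _).le)
      rw [pow_succ, hψ1, ← integral_prod_mul]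
      refine Eq.trans (integral_congr_ae (Filter.Eventually.of_forall fun z => ?_)) h
      simp only [inner_add_left, neg_add, AddChar.map_add_eq_mul, Circle.coe_mul]
      ring
    · calc ∫⁻ y, ‖φ y‖ₑ * u y ∂(convPow μ (n + 1))
          ≤ ∫⁻ z, ‖ψ z.1 * g z.2‖ₑ * u (z.1 + z.2) ∂((convPow μ n).prod μ) := hφ2 u hu
        _ = ∫⁻ ξ, ∫⁻ y, ‖ψ y * g ξ‖ₑ * u (y + ξ) ∂(convPow μ n) ∂μ := by
            rw [lintegral_prod_symm' _ (by fun_prop)]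
        _ = ∫⁻ ξ, ‖g ξ‖ₑ * ∫⁻ y, ‖ψ y‖ₑ * u (y + ξ) ∂(convPow μ n) ∂μ := by
            refine lintegral_congr fun ξ => ?_
            rw [← lintegral_const_mul _ (by fun_prop)]
            refine lintegral_congr fun y => ?_
            rw [enorm_mul]; ring
        _ ≤ ∫⁻ ξ, K ^ n * (‖g ξ‖ₑ * (∫⁻ y, u (y + ξ) ^ q ∂(convPow μ n)) ^ (1 / q)) ∂μ := by
            refine lintegral_mono fun ξ => ?_
            rw [mul_left_comm]
            gcongr
            exact hψ2 (fun y => u (y + ξ)) (by fun_prop)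
        _ ≤ K ^ n * (K * (∫⁻ ξ, ((∫⁻ y, u (y + ξ) ^ q ∂(convPow μ n)) ^ (1 / q)) ^ q ∂μ) ^
              (1 / q)) := by
            have hm : Measurable fun ξ => ∫⁻ y, u (y + ξ) ^ q ∂(convPow μ n) :=
              Measurable.lintegral_prod_left' (f := fun z : E × E => u (z.1 + z.2) ^ q)
                (by fun_prop)
            rw [lintegral_const_mul _ (by fun_prop)]
            gcongr
            exact hK _ (by fun_prop)
        _ = K ^ (n + 1) * (∫⁻ y, u y ^ q ∂(convPow μ (n + 1))) ^ (1 / q) := by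
            rw [← mul_assoc, ← pow_succ]
            congr 2
            rw [convPow, Measure.conv, lintegral_map (by fun_prop) (by fun_prop),
              lintegral_prod_symm' _ (by fun_prop)]
            refine lintegral_congr fun ξ => ?_
            rw [← ENNReal.rpow_mul, one_div_mul_cancel hq0.ne', ENNReal.rpow_one]

end Convolution

/-! ### Estimates for the density -/

section Density

/-- The density in `MeasureMemLp` can be chosen measurable. -/
theorem MeasureMemLp.exists_measurable {E : Type*} [MeasureSpace E] {ν : Measure E} {r : ℝ≥0∞}
    (h : MeasureMemLp ν r) : ∃ g : E → ℝ, Measurable g ∧ (∀ x, 0 ≤ g x) ∧ MemLp g r volume ∧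
      ν = volume.withDensity (fun x => ENNReal.ofReal (g x)) := by
  obtain ⟨g, hg0, hg, hν⟩ := h
  set g' : E → ℝ := fun x => max (hg.1.mk g x) 0 with hg'
  have hae : g =ᵐ[volume] g' := by
    filter_upwards [hg.1.ae_eq_mk] with x hx
    rw [hg']
    simp [← hx, hg0 x]
  refine ⟨g', hg.1.stronglyMeasurable_mk.measurable.max measurable_const,
    fun x => le_max_right _ _, (memLp_congr_ae hae).1 hg, ?_⟩
  rw [hν]
  refine withDensity_congr_ae ?_
  filter_upwards [hae] with x hx
  rw [hx]

variable {E : Type*} [MeasureSpace E]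

/-- A nonnegative function in `L¹ ∩ L^r` is in `L^a` for `1 ≤ a ≤ r`. -/
theorem lintegral_ofReal_rpow_ne_top {h : E → ℝ} (hm : Measurable h) (h0 : ∀ x, 0 ≤ h x)
    {r : ℝ≥0∞} (hr : MemLp h r volume) (hint : ∫⁻ x, ENNReal.ofReal (h x) ≠ ∞) {a : ℝ}
    (ha1 : 1 ≤ a) (har : ENNReal.ofReal a ≤ r) :
    ∫⁻ x, ENNReal.ofReal (h x) ^ a ≠ ∞ := by
  rcases eq_or_ne r ∞ with rfl | hrt
  · have hb : ∀ᵐ x, ‖h x‖ₑ ≤ eLpNorm h ∞ volume := by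
      rw [eLpNorm_exponent_top]; exact ae_le_eLpNormEssSup
    refine ne_top_of_le_ne_top (b := ∫⁻ x, eLpNorm h ∞ volume ^ (a - 1) * ENNReal.ofReal (h x))
      ?_ (lintegral_mono_ae ?_)
    · rw [lintegral_const_mul _ (by fun_prop)]
      exact ENNReal.mul_ne_top (ENNReal.rpow_ne_top_of_nonneg (by linarith) hr.2.ne) hint
    · filter_upwards [hb] with x hx
      rw [Real.enorm_of_nonneg (h0 x)] at hx
      have : ENNReal.ofReal (h x) ^ a = ENNReal.ofReal (h x) ^ (a - 1) * ENNReal.ofReal (h x) := by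
        conv_lhs => rw [show a = (a - 1) + 1 by ring]
        rw [ENNReal.rpow_add_of_nonneg _ _ (by linarith) zero_le_one, ENNReal.rpow_one]
      rw [this]
      gcongr
  · have hr0 : r ≠ 0 := by
      rintro rfl
      simp at har
      linarith
    have hfin := lintegral_rpow_enorm_lt_top_of_eLpNorm_lt_top hr0 hrt hr.2
    have har' : a ≤ r.toReal := by
      rwa [← ENNReal.ofReal_le_iff_le_toReal hrt]
    refine ne_top_of_le_ne_top (b := ∫⁻ x, (ENNReal.ofReal (h x) + ‖h x‖ₑ ^ r.toReal)) ?_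
      (lintegral_mono fun x => ?_)
    · rw [lintegral_add_left (by fun_prop)]
      exact ENNReal.add_ne_top.2 ⟨hint, hfin.ne⟩
    · simp only [Real.enorm_of_nonneg (h0 x)]
      rcases le_total (ENNReal.ofReal (h x)) 1 with h1 | h1
      · refine le_trans ?_ le_self_add
        simpa using ENNReal.rpow_le_rpow_of_exponent_ge h1 ha1
      · refine le_trans ?_ le_add_self
        exact ENNReal.rpow_le_rpow_of_exponent_le h1 har'

theorem lintegral_rpow_mul_ofReal_le {h : E → ℝ} (hm : Measurable h) (h0 : ∀ x, 0 ≤ h x)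
    {r r' : ℝ≥0∞} (hrr' : ENNReal.HolderConjugate r r') (hr't : r' ≠ ∞)
    {b : ℝ} (hb : 0 ≤ b) {G : E → ℂ} (hG : Measurable G) :
    ∫⁻ x, ‖G x‖ₑ ^ b * ENNReal.ofReal (h x) ≤
      eLpNorm h r volume * (∫⁻ x, ‖G x‖ₑ ^ (b * r'.toReal)) ^ (1 / r'.toReal) := by
  have hr'0 : r' ≠ 0 := by
    have := hrr'.symm
    exact (ENNReal.HolderConjugate.pos r' r).ne'
  have h1 := eLpNorm_smul_le_mul_eLpNorm (μ := (volume : Measure E)) (p := r) (q := r') (r := 1)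
    (f := fun x => ‖G x‖ ^ b) (φ := h) (by fun_prop) (by fun_prop)
  have he : ∀ x, ‖‖G x‖ ^ b‖ₑ = ‖G x‖ₑ ^ b := fun x => by
    rw [Real.enorm_of_nonneg (by positivity), ← ofReal_norm,
      ENNReal.ofReal_rpow_of_nonneg (norm_nonneg _) hb]
  rw [eLpNorm_one_eq_lintegral_enorm,
    eLpNorm_eq_lintegral_rpow_enorm_toReal (p := r') hr'0 hr't] at h1
  simp only [Pi.smul_apply', enorm_smul, he, ← ENNReal.rpow_mul, Real.enorm_of_nonneg (h0 _)] at h1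
  simpa only [mul_comm (ENNReal.ofReal _)] using h1

/-- If `φ` is bounded by `K` as a functional on `L^q(h dx)` and `h` is in `L^r`, then `h φ` is
bounded by `K ‖h‖_r ^ (1 / q)` in `L^a`, where `a` is the conjugate exponent of `s = r' q`. The
proof tests `φ` against `‖h φ‖ ^ (a - 1)`. -/
theorem lintegral_density_rpow_le {h : E → ℝ} (hm : Measurable h)
    (h0 : ∀ x, 0 ≤ h x) {r r' : ℝ≥0∞} (hrr' : ENNReal.HolderConjugate r r') (hr't : r' ≠ ∞)
    (hr : MemLp h r volume) (hint : ∫⁻ x, ENNReal.ofReal (h x) ≠ ∞)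
    {q s a : ℝ} (hq : 1 ≤ q) (hs : s = r'.toReal * q) (hs1 : 1 < s) (ha : (a - 1) * (s - 1) = 1)
    {φ : E → ℂ} (hφ : Measurable φ) {M : ℝ} (hM : ∀ y, ‖φ y‖ ≤ M) {K : ℝ≥0∞}
    (hK : ∀ u : E → ℝ≥0∞, Measurable u →
      ∫⁻ y, ‖φ y‖ₑ * u y ∂(volume.withDensity fun x => ENNReal.ofReal (h x)) ≤
        K * (∫⁻ y, u y ^ q ∂(volume.withDensity fun x => ENNReal.ofReal (h x))) ^ (1 / q)) :
    (∫⁻ x, ‖(h x : ℂ) * φ x‖ₑ ^ a) ^ (1 / a) ≤ K * eLpNorm h r volume ^ (1 / q) := by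
  have ha1 : 0 < a - 1 := by
    by_contra h
    nlinarith
  have hρ : 1 ≤ r'.toReal := by
    have := hrr'.symm
    have h1 : 1 ≤ r' := ENNReal.HolderConjugate.one_le r' r
    simpa using ENNReal.toReal_mono hr't h1
  have has : 1 / a = 1 - 1 / s := by
    have : a ≠ 0 := by linarith
    have : s ≠ 0 := by linarith
    field_simp
    nlinarith
  set G : E → ℂ := fun x => (h x : ℂ) * φ x with hG
  have hGm : Measurable G := by fun_prop
  have hGe : ∀ x, ‖G x‖ₑ = ENNReal.ofReal (h x) * ‖φ x‖ₑ := fun x => by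
    rw [hG, enorm_mul, ← ofReal_norm (h x : ℂ), Complex.norm_real, Real.norm_of_nonneg (h0 x)]
  set I := ∫⁻ x, ‖G x‖ₑ ^ a with hI
  have hofm : Measurable fun x => ENNReal.ofReal (h x) := by fun_prop
  -- `a ≤ r`, because `1 / r = 1 - 1 / r' ≤ 1 - 1 / (r' q) = 1 / a`
  have har : ENNReal.ofReal a ≤ r := by
    have e1 : r⁻¹ = 1 - r'⁻¹ := by
      have := ENNReal.HolderConjugate.inv_add_inv_eq_one r r'
      rw [← this, ENNReal.add_sub_cancel_right]
      exact ENNReal.inv_ne_top.2 (by rintro rfl; simp at hρ; linarith)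
    rw [← ENNReal.inv_le_inv, e1, ← ENNReal.ofReal_inv_of_pos (by linarith), ← one_div a, has,
      ← ENNReal.ofReal_toReal hr't, ← ENNReal.ofReal_inv_of_pos (by linarith),
      ← ENNReal.ofReal_one, ← ENNReal.ofReal_sub _ (by positivity)]
    refine ENNReal.ofReal_le_ofReal ?_
    rw [one_div]
    gcongr
    rw [hs]
    nlinarith
  -- the a priori finiteness of `I`, needed to divide by a power of it in the end
  have hIfin : I ≠ ∞ := by
    have hb := lintegral_ofReal_rpow_ne_top hm h0 hr hint (by linarith : 1 ≤ a) har
    refine ne_top_of_le_ne_top (b := ∫⁻ x, ENNReal.ofReal M ^ a * ENNReal.ofReal (h x) ^ a) ?_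
      (lintegral_mono fun x => ?_)
    · rw [lintegral_const_mul _ (by fun_prop)]
      exact ENNReal.mul_ne_top
        (ENNReal.rpow_ne_top_of_nonneg (by linarith) ENNReal.ofReal_ne_top) hb
    · rw [hGe, ENNReal.mul_rpow_of_nonneg _ _ (by linarith), mul_comm]
      refine mul_le_mul' (ENNReal.rpow_le_rpow ?_ (by linarith)) le_rfl
      rw [← ofReal_norm]
      exact ENNReal.ofReal_le_ofReal (hM x)
  have hmain : I ≤ (K * eLpNorm h r volume ^ (1 / q)) * I ^ (1 / s) := by
    calc I = ∫⁻ x, ‖φ x‖ₑ * ‖G x‖ₑ ^ (a - 1)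
            ∂(volume.withDensity fun x => ENNReal.ofReal (h x)) := by
          rw [lintegral_withDensity_eq_lintegral_mul _ hofm (by fun_prop)]
          refine lintegral_congr fun x => ?_
          rw [Pi.mul_apply, ← mul_assoc, ← hGe]
          conv_lhs => rw [show a = 1 + (a - 1) by ring]
          rw [ENNReal.rpow_add_of_nonneg _ _ zero_le_one ha1.le, ENNReal.rpow_one]
      _ ≤ K * (∫⁻ x, (‖G x‖ₑ ^ (a - 1)) ^ q
            ∂(volume.withDensity fun x => ENNReal.ofReal (h x))) ^ (1 / q) := hK _ (by fun_prop)
      _ = K * (∫⁻ x, ‖G x‖ₑ ^ ((a - 1) * q) * ENNReal.ofReal (h x)) ^ (1 / q) := by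
          rw [lintegral_withDensity_eq_lintegral_mul _ hofm (by fun_prop)]
          simp only [Pi.mul_apply, ENNReal.rpow_mul, mul_comm (ENNReal.ofReal _)]
      _ ≤ K * (eLpNorm h r volume *
            (∫⁻ x, ‖G x‖ₑ ^ ((a - 1) * q * r'.toReal)) ^ (1 / r'.toReal)) ^ (1 / q) := by
          gcongr
          exact lintegral_rpow_mul_ofReal_le hm h0 hrr' hr't (by positivity) hGm
      _ = _ := by
          rw [show (a - 1) * q * r'.toReal = a by rw [mul_assoc, mul_comm q, ← hs]; nlinarith,
            ENNReal.mul_rpow_of_nonneg _ _ (by positivity), ← ENNReal.rpow_mul, mul_assoc, hs,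
            div_mul_div_comm, one_mul]
  rcases eq_or_ne I 0 with hI0 | hI0
  · rw [hI0, ENNReal.zero_rpow_of_pos (one_div_pos.2 (by linarith))]
    exact bot_le
  have hIs0 : I ^ (1 / s) ≠ 0 := by simp [ENNReal.rpow_eq_zero_iff, hI0, hIfin]
  have hIst : I ^ (1 / s) ≠ ∞ := ENNReal.rpow_ne_top_of_nonneg (by positivity) hIfin
  rw [has, ENNReal.rpow_sub _ _ hI0 hIfin, ENNReal.rpow_one]
  exact ENNReal.div_le_of_le_mul hmain

end Density

/-! ### Extension and restriction -/

section Restriction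

variable {E : Type*} [NormedAddCommGroup E] [InnerProductSpace ℝ E] [FiniteDimensional ℝ E]
  [MeasurableSpace E] [BorelSpace E] [SecondCountableTopology E] [StandardBorelSpace E]

/-- The extension estimate `‖(g μ)^‖_{n s} ≤ C K`, where `K` bounds `g` as a functional on
`L^q(μ)`: the `n`-th power of the transform of `g μ` is the Fourier transform of a function
`h φ`, to which Hausdorff–Young applies. -/
theorem exists_lintegral_extension_le (μ : Measure E) [IsProbabilityMeasure μ] {n : ℕ}
    (hn : n ≠ 0) {r r' : ℝ≥0∞} (hrr' : ENNReal.HolderConjugate r r') (hr't : r' ≠ ∞)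
    (hμ : MeasureMemLp (convPow μ n) r) {q s : ℝ} (hq : 1 ≤ q) (hs : s = r'.toReal * q)
    (hs2 : 2 ≤ s) :
    ∃ C : ℝ≥0∞, C ≠ ∞ ∧ ∀ (g : E → ℂ) (M : ℝ) (K : ℝ≥0∞), Measurable g → (∀ ξ, ‖g ξ‖ ≤ M) →
      (∀ v : E → ℝ≥0∞, Measurable v →
        ∫⁻ ξ, ‖g ξ‖ₑ * v ξ ∂μ ≤ K * (∫⁻ ξ, v ξ ^ q ∂μ) ^ (1 / q)) →
      (∫⁻ x, ‖∫ ξ, (Real.fourierChar (-inner ℝ ξ x) : ℂ) * g ξ ∂μ‖ₑ ^ (n * s)) ^ (1 / (n * s)) ≤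
        C * K := by
  obtain ⟨h, hm, h0, hr, hν⟩ := hμ.exists_measurable
  have hn0 : (0 : ℝ) < n := by positivity
  set a : ℝ := 1 + 1 / (s - 1) with ha
  have ha' : (a - 1) * (s - 1) = 1 := by
    have : s - 1 ≠ 0 := by linarith
    rw [ha]; field_simp; ring
  have ha0 : 0 < a := by
    have : 0 < 1 / (s - 1) := one_div_pos.2 (by linarith)
    linarith
  obtain ⟨C, -, hC⟩ := exists_lintegral_fourier_rpow_le (E := E) hs2 ha'
  have hint : ∫⁻ x, ENNReal.ofReal (h x) = 1 := by
    have := measure_univ (μ := convPow μ n)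
    rwa [hν, withDensity_apply _ MeasurableSet.univ, Measure.restrict_univ] at this
  refine ⟨(C : ℝ≥0∞) ^ (1 / (n * s)) * (eLpNorm h r volume ^ (1 / q)) ^ (1 / (n : ℝ)), ?_,
    fun g M K hg hM hK => ?_⟩
  · refine ENNReal.mul_ne_top (ENNReal.rpow_ne_top_of_nonneg (by positivity) ENNReal.coe_ne_top)
      (ENNReal.rpow_ne_top_of_nonneg (by positivity)
        (ENNReal.rpow_ne_top_of_nonneg (by positivity) hr.2.ne))
  obtain ⟨φ, hφ, hφM, hφ1, hφ2⟩ := exists_convPow_multiplier μ hq hg hM hK n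
  set D : E → ℂ := fun x => ∫ ξ, (Real.fourierChar (-inner ℝ ξ x) : ℂ) * g ξ ∂μ with hD
  set G : E → ℂ := fun x => (h x : ℂ) * φ x with hG
  have hofm : Measurable fun x => ENNReal.ofReal (h x) := by fun_prop
  have hFG : ∀ x, D x ^ n = 𝓕 G x := by
    intro x
    rw [hφ1 x, hν, integral_withDensity_eq_integral_toReal_smul hofm (by simp), Real.fourier_eq]
    refine integral_congr_ae (Filter.Eventually.of_forall fun y => ?_)
    simp only [hG, ENNReal.toReal_ofReal (h0 _), Circle.smul_def, Complex.real_smul, smul_eq_mul]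
    ring
  have hGi : Integrable G := by
    have hhi : Integrable h := by
      refine ⟨hm.aestronglyMeasurable, ?_⟩
      rw [hasFiniteIntegral_iff_ofReal (Filter.Eventually.of_forall h0), hint]
      exact ENNReal.one_lt_top
    exact hhi.ofReal.mul_bdd hφ.aestronglyMeasurable (Filter.Eventually.of_forall hφM)
  have hGa : (∫⁻ x, ‖G x‖ₑ ^ a) ^ (1 / a) ≤ K ^ n * eLpNorm h r volume ^ (1 / q) := by
    rw [hν] at hφ2
    exact lintegral_density_rpow_le hm h0 hrr' hr't hr (by simp [hint]) hq hs (by linarith) ha' hφ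
      hφM hφ2
  have hpow : ∫⁻ x, ‖D x‖ₑ ^ (n * s) ≤ C * (K ^ n * eLpNorm h r volume ^ (1 / q)) ^ s := by
    calc ∫⁻ x, ‖D x‖ₑ ^ (n * s) = ∫⁻ x, ‖𝓕 G x‖ₑ ^ s := by
          refine lintegral_congr fun x => ?_
          rw [← hFG, enorm_pow, ENNReal.rpow_mul, ENNReal.rpow_natCast]
      _ ≤ C * (∫⁻ x, ‖G x‖ₑ ^ a) ^ (s - 1) := hC G (by fun_prop) hGi
      _ = C * ((∫⁻ x, ‖G x‖ₑ ^ a) ^ (1 / a)) ^ s := by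
          rw [← ENNReal.rpow_mul]
          congr 2
          field_simp
          nlinarith
      _ ≤ _ := by gcongr
  calc _ ≤ (C * (K ^ n * eLpNorm h r volume ^ (1 / q)) ^ s) ^ (1 / (n * s)) := by gcongr
    _ = _ := by
      rw [ENNReal.mul_rpow_of_nonneg _ _ (by positivity), ← ENNReal.rpow_mul,
        show s * (1 / (n * s)) = 1 / (n : ℝ) by field_simp,
        ENNReal.mul_rpow_of_nonneg (K ^ n) _ (by positivity), ← ENNReal.rpow_natCast,
        ← ENNReal.rpow_mul, mul_one_div_cancel hn0.ne', ENNReal.rpow_one]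
      ring

/-- The restriction estimate at the largest admissible `q`, dual to
`exists_lintegral_extension_le`. -/
theorem exists_lintegral_restriction_le (μ : Measure E) [IsProbabilityMeasure μ] {n : ℕ}
    (hn : n ≠ 0) {r r' : ℝ≥0∞} (hrr' : ENNReal.HolderConjugate r r') (hr't : r' ≠ ∞)
    (hμ : MeasureMemLp (convPow μ n) r) {q s p : ℝ} (hq : 1 ≤ q) (hs : s = r'.toReal * q)
    (hs2 : 2 ≤ s) (hp : Real.HolderConjugate p (n * s)) :
    ∃ C : ℝ≥0∞, C ≠ ∞ ∧ ∀ f : 𝓢(E, ℂ),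
      (∫⁻ ξ, ‖𝓕 (f : E → ℂ) ξ‖ₑ ^ q ∂μ) ^ (1 / q) ≤ C * (∫⁻ x, ‖f x‖ₑ ^ p) ^ (1 / p) := by
  obtain ⟨C, hCt, hC⟩ := exists_lintegral_extension_le μ hn hrr' hr't hμ hq hs hs2
  refine ⟨C, hCt, fun f => ?_⟩
  have hq0 : 0 < q := by linarith
  set w : E → ℂ := 𝓕 (f : E → ℂ) with hw
  have hwc : Continuous w := continuous_fourier_of_integrable f.integrable
  set B : ℝ := ∫ x, ‖f x‖ with hB
  have hwB : ∀ ξ, ‖w ξ‖ ≤ B := fun ξ => by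
    exact VectorFourier.norm_fourierIntegral_le_integral_norm _ _ _ _ _
  have hB0 : 0 ≤ B := (norm_nonneg _).trans (hwB 0)
  set N := ∫⁻ ξ, ‖w ξ‖ₑ ^ q ∂μ with hN
  have hNt : N ≠ ∞ := by
    refine ne_top_of_le_ne_top (b := ∫⁻ _, ENNReal.ofReal B ^ q ∂μ) ?_ (lintegral_mono fun ξ => ?_)
    · simp [hq0.le]
    · simp only [← ofReal_norm]
      gcongr
      exact hwB ξ
  rcases eq_or_ne N 0 with hN0 | hN0
  · rw [hN0, ENNReal.zero_rpow_of_pos (by positivity)]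
    exact bot_le
  -- `g` is dual to `w`: `w g = ‖w‖ ^ q` and `‖g‖ ≤ ‖w‖ ^ (q - 1)`; where `w = 0` it vanishes,
  -- whatever the value of `‖w‖ ^ (q - 2)`
  set g : E → ℂ := fun ξ => (starRingEnd ℂ) (w ξ) * ((‖w ξ‖ ^ (q - 2) : ℝ) : ℂ) with hg
  have hgm : Measurable g := by
    have := hwc.measurable
    have h2 : Measurable fun ξ => (starRingEnd ℂ) (w ξ) :=
      Complex.continuous_conj.measurable.comp this
    fun_prop
  have hgn : ∀ ξ, ‖g ξ‖ ≤ ‖w ξ‖ ^ (q - 1) := fun ξ => by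
    rcases eq_or_ne (w ξ) 0 with h | h
    · simp only [hg, h, map_zero, zero_mul, norm_zero]
      positivity
    · have h1 : 0 < ‖w ξ‖ := norm_pos_iff.2 h
      rw [hg, norm_mul, RCLike.norm_conj, Complex.norm_real, Real.norm_of_nonneg (by positivity),
        show q - 1 = 1 + (q - 2) by ring, Real.rpow_add h1, Real.rpow_one]
  have hwg : ∀ ξ, w ξ * g ξ = ((‖w ξ‖ ^ q : ℝ) : ℂ) := fun ξ => by
    rcases eq_or_ne (w ξ) 0 with h | h
    · simp [h, Real.zero_rpow hq0.ne']
    · have h1 : 0 < ‖w ξ‖ := norm_pos_iff.2 h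
      rw [hg, ← mul_assoc, Complex.mul_conj, Complex.normSq_eq_norm_sq, ← Complex.ofReal_mul,
        ← Real.rpow_two, ← Real.rpow_add h1]
      congr 2; ring
  have hgB : ∀ ξ, ‖g ξ‖ ≤ B ^ (q - 1) := fun ξ =>
    (hgn ξ).trans (Real.rpow_le_rpow (norm_nonneg _) (hwB ξ) (by linarith))
  have hgK : ∀ v : E → ℝ≥0∞, Measurable v →
      ∫⁻ ξ, ‖g ξ‖ₑ * v ξ ∂μ ≤ N ^ (1 - 1 / q) * (∫⁻ ξ, v ξ ^ q ∂μ) ^ (1 / q) := by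
    intro v hv
    have hq1 : 0 ≤ 1 - 1 / q := by
      rw [sub_nonneg, div_le_one hq0]; exact hq
    have hwm := hwc.measurable
    calc ∫⁻ ξ, ‖g ξ‖ₑ * v ξ ∂μ ≤ ∫⁻ ξ, (‖w ξ‖ₑ ^ q) ^ (1 - 1 / q) * (v ξ ^ q) ^ (1 / q) ∂μ := by
          refine lintegral_mono fun ξ => ?_
          rw [← ENNReal.rpow_mul, ← ENNReal.rpow_mul, mul_one_div_cancel hq0.ne', ENNReal.rpow_one,
            show q * (1 - 1 / q) = q - 1 by field_simp]
          gcongr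
          rw [← ofReal_norm, ← ofReal_norm, ENNReal.ofReal_rpow_of_nonneg (norm_nonneg _)
            (by linarith)]
          exact ENNReal.ofReal_le_ofReal (hgn ξ)
      _ ≤ _ := ENNReal.lintegral_mul_norm_pow_le (by fun_prop) (by fun_prop) hq1 (by positivity)
          (by ring)
  have hext := hC g _ _ hgm hgB hgK
  set D : E → ℂ := fun x => ∫ ξ, (Real.fourierChar (-inner ℝ ξ x) : ℂ) * g ξ ∂μ with hD
  have hgi : Integrable g μ := Integrable.of_bound hgm.aestronglyMeasurable _
    (Filter.Eventually.of_forall hgB)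
  have hDV : D = VectorFourier.fourierIntegral Real.fourierChar μ (innerₗ E) g := rfl
  have hDc : Continuous D := by
    rw [hDV]
    exact VectorFourier.fourierIntegral_continuous Real.continuous_fourierChar
      (by exact continuous_inner) hgi
  have hflip : ∫ ξ, w ξ * g ξ ∂μ = ∫ x, f x * D x := by
    rw [hDV]
    have := VectorFourier.integral_fourierIntegral_smul_eq_flip (L := innerₗ E) (ν := μ)
      Real.continuous_fourierChar (by exact continuous_inner) (f.integrable (μ := volume)) hgi
    rw [flip_innerₗ] at this
    exact this
  have hNint : N = ‖∫ ξ, w ξ * g ξ ∂μ‖ₑ := by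
    simp_rw [hwg]
    rw [integral_complex_ofReal, ← ofReal_norm, Complex.norm_real,
      Real.norm_of_nonneg (integral_nonneg fun ξ => by positivity),
      ofReal_integral_eq_lintegral_ofReal]
    · refine lintegral_congr fun ξ => ?_
      rw [← ofReal_norm, ENNReal.ofReal_rpow_of_nonneg (norm_nonneg _) hq0.le]
    · refine Integrable.of_bound (C := B ^ q) ?_ (Filter.Eventually.of_forall fun ξ => ?_)
      · exact (hwc.norm.measurable.pow_const q).aestronglyMeasurable
      · rw [Real.norm_of_nonneg (by positivity)]
        exact Real.rpow_le_rpow (norm_nonneg _) (hwB ξ) hq0.le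
    · exact Filter.Eventually.of_forall fun ξ => by positivity
  have hmain : N ≤ (C * (∫⁻ x, ‖f x‖ₑ ^ p) ^ (1 / p)) * N ^ (1 - 1 / q) := by
    calc N = ‖∫ x, f x * D x‖ₑ := by rw [hNint, hflip]
      _ ≤ ∫⁻ x, ‖f x‖ₑ * ‖D x‖ₑ := by
          simpa only [enorm_mul] using enorm_integral_le_lintegral_enorm (fun x => f x * D x)
      _ ≤ (∫⁻ x, ‖f x‖ₑ ^ p) ^ (1 / p) * (∫⁻ x, ‖D x‖ₑ ^ (n * s)) ^ (1 / (n * s)) :=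
          ENNReal.lintegral_mul_le_Lp_mul_Lq _ hp f.continuous.measurable.enorm.aemeasurable
            hDc.measurable.enorm.aemeasurable
      _ ≤ (∫⁻ x, ‖f x‖ₑ ^ p) ^ (1 / p) * (C * N ^ (1 - 1 / q)) := by gcongr
      _ = _ := by ring
  rw [show 1 / q = 1 - (1 - 1 / q) by ring, ENNReal.rpow_sub _ _ hN0 hNt, ENNReal.rpow_one]
  exact ENNReal.div_le_of_le_mul hmain

end Restriction

theorem theorem1 (d : ℕ) (μ : Measure (EuclideanSpace ℝ (Fin d))) [IsProbabilityMeasure μ]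
    (n : ℕ) (hn : 1 ≤ n)
    -- exponents in `[1, ∞]`, with `r'` and `p'` the conjugate exponents of `r` and `p`
    (r r' p p' q : ℝ≥0∞) (hrr' : ENNReal.HolderConjugate r r')
    (hpp' : ENNReal.HolderConjugate p p')
    (hr : 1 ≤ r) (hμ : MeasureMemLp (convPow μ n) r)
    (hp : 1 ≤ p)
    (hp_of_two_le : 2 ≤ r → p ≤ 2 * (n : ℝ≥0∞) / (2 * (n : ℝ≥0∞) - 1))
    (hp_of_le_two : r ≤ 2 → p ≤ ratioPred ((n : ℝ≥0∞) * r'))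
    (hq : 1 ≤ q)
    -- for `p = 1`, i.e. `p' = ∞`, the upper bound for `q` is `∞` (also if `r' = ∞`)
    (hq_le : p = 1 ∨ q ≤ p' / ((n : ℝ≥0∞) * r')) :
    ∃ C : ℝ≥0, 0 < C ∧ ∀ f : 𝓢(EuclideanSpace ℝ (Fin d), ℂ),
      eLpNorm (𝓕 (f : EuclideanSpace ℝ (Fin d) → ℂ)) q μ ≤
        C * eLpNorm (f : EuclideanSpace ℝ (Fin d) → ℂ) p volume := by
  have hcont : ∀ f : 𝓢(EuclideanSpace ℝ (Fin d), ℂ),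
      Continuous (𝓕 (f : EuclideanSpace ℝ (Fin d) → ℂ)) := fun f =>
    continuous_fourier_of_integrable f.integrable
  -- for `p = 1` the bound `‖𝓕 f‖_∞ ≤ ‖f‖_1` suffices
  rcases eq_or_ne p 1 with rfl | hp1
  · refine ⟨1, one_pos, fun f => ?_⟩
    calc eLpNorm (𝓕 (f : EuclideanSpace ℝ (Fin d) → ℂ)) q μ
        ≤ eLpNorm (𝓕 (f : EuclideanSpace ℝ (Fin d) → ℂ)) ∞ μ :=
          eLpNorm_le_eLpNorm_of_exponent_le le_top (hcont f).aestronglyMeasurable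
      _ ≤ ∫⁻ x, ‖f x‖ₑ := by
          rw [eLpNorm_exponent_top]
          exact essSup_le_of_ae_le _ (Filter.Eventually.of_forall (enorm_fourier_le f))
      _ = _ := by simp [eLpNorm_one_eq_lintegral_enorm]
  have hq_le := hq_le.resolve_left hp1
  have hp't : p' ≠ ∞ := by
    rintro rfl
    exact hp1 (by simpa using ENNReal.HolderConjugate.inv_add_inv_eq_one p ∞)
  have hn0 : (n : ℝ≥0∞) ≠ 0 := by
    simp; omega
  have hnr : (n : ℝ≥0∞) * r' ≤ p' := by
    have h1 : 1 ≤ p' / ((n : ℝ≥0∞) * r') := hq.trans hq_le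
    by_contra h
    push Not at h
    exact absurd h1 (not_le.2 (ENNReal.div_lt_of_lt_mul (by simpa using h)))
  have hr't : r' ≠ ∞ := by
    rintro rfl
    rw [ENNReal.mul_top hn0, top_le_iff] at hnr
    exact hp't hnr
  have hr'0 : 0 < r' := by
    have := hrr'.symm
    exact ENNReal.HolderConjugate.pos r' r
  -- `2 n ≤ p'`, so that Hausdorff–Young is available for the exponent `p' / n`
  have h2n : 2 * (n : ℝ≥0∞) ≤ p' := by
    rcases le_total 2 r with h2 | h2
    · have hle := ENNReal.inv_le_inv.2 (hp_of_two_le h2)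
      have h2n0 : 2 * (n : ℝ≥0∞) ≠ 0 := mul_ne_zero two_ne_zero hn0
      have h2nt : 2 * (n : ℝ≥0∞) ≠ ∞ :=
        ENNReal.mul_ne_top ENNReal.ofNat_ne_top (ENNReal.natCast_ne_top n)
      have h2n1 : 1 ≤ 2 * (n : ℝ≥0∞) := by exact_mod_cast (by omega : 1 ≤ 2 * n)
      rw [ENNReal.inv_div (Or.inr h2nt) (Or.inr h2n0)] at hle
      have hsum : (2 * (n : ℝ≥0∞) - 1) / (2 * n) + (2 * (n : ℝ≥0∞))⁻¹ = 1 := by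
        rw [← one_div, ENNReal.div_add_div_same, tsub_add_cancel_of_le h2n1,
          ENNReal.div_self h2n0 h2nt]
      rw [← ENNReal.inv_le_inv]
      have hne : (2 * (n : ℝ≥0∞) - 1) / (2 * n) ≠ ∞ :=
        ENNReal.div_ne_top (ENNReal.sub_ne_top h2nt) h2n0
      refine (ENNReal.add_le_add_iff_left hne).1 ?_
      exact (add_le_add hle le_rfl).trans
        ((ENNReal.HolderConjugate.inv_add_inv_eq_one p p').trans hsum.symm).le
    · have h2' : 2 ≤ r' := by
        have e := ENNReal.HolderConjugate.inv_add_inv_eq_one r r'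
        rw [← ENNReal.inv_le_inv]
        refine (ENNReal.add_le_add_iff_left (a := 2⁻¹) (by simp)).1 ?_
        rw [ENNReal.inv_two_add_inv_two, ← e]
        gcongr
      calc 2 * (n : ℝ≥0∞) = n * 2 := mul_comm _ _
        _ ≤ n * r' := by gcongr
        _ ≤ p' := hnr
  have hpt : p ≠ ∞ := by
    rintro rfl
    have e : p' = 1 := by simpa using ENNReal.HolderConjugate.inv_add_inv_eq_one ∞ p'
    rw [e] at h2n
    have : (2 : ℝ≥0∞) * 1 ≤ 2 * n := by gcongr; exact_mod_cast hn
    exact absurd (this.trans h2n) (by norm_num)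
  have hρ0 : (0 : ℝ) < r'.toReal := ENNReal.toReal_pos hr'0.ne' hr't
  have hnrr : (n : ℝ) * r'.toReal ≤ p'.toReal := by
    simpa using ENNReal.toReal_mono hp't hnr
  have h2nr : 2 * (n : ℝ) ≤ p'.toReal := by
    simpa using ENNReal.toReal_mono hp't h2n
  -- `μ` being a probability measure, the largest admissible `q` suffices
  set q₀ : ℝ := p'.toReal / (n * r'.toReal) with hq₀
  have hn1 : (0 : ℝ) < n := by positivity
  have hq₀1 : 1 ≤ q₀ := by
    rw [hq₀, one_le_div (by positivity)]; exact hnrr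
  have hs : (n : ℝ) * (r'.toReal * q₀) = p'.toReal := by
    rw [hq₀]; field_simp
  have hqq₀ : q ≤ ENNReal.ofReal q₀ := by
    refine hq_le.trans (le_of_eq ?_)
    rw [hq₀, ENNReal.ofReal_div_of_pos (by positivity), ENNReal.ofReal_mul (by positivity),
      ENNReal.ofReal_toReal hp't, ENNReal.ofReal_toReal hr't, ENNReal.ofReal_natCast]
  have hpR : p.toReal.HolderConjugate (n * (r'.toReal * q₀)) := by
    rw [hs]
    exact ENNReal.HolderConjugate.toReal_of_ne_top hpt hp't
  obtain ⟨C, hCt, hC⟩ := exists_lintegral_restriction_le μ (by omega) hrr' hr't hμ hq₀1 rfl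
    (by
      have : r'.toReal * q₀ = p'.toReal / n := by rw [← hs]; field_simp
      rw [this, le_div_iff₀ (by positivity)]; exact h2nr) hpR
  refine ⟨C.toNNReal + 1, by positivity, fun f => ?_⟩
  calc eLpNorm (𝓕 (f : EuclideanSpace ℝ (Fin d) → ℂ)) q μ
      ≤ eLpNorm (𝓕 (f : EuclideanSpace ℝ (Fin d) → ℂ)) (ENNReal.ofReal q₀) μ :=
        eLpNorm_le_eLpNorm_of_exponent_le hqq₀ (hcont f).aestronglyMeasurable
    _ ≤ C * eLpNorm (f : EuclideanSpace ℝ (Fin d) → ℂ) p volume := by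
        rw [eLpNorm_eq_lintegral_rpow_enorm_toReal (by simp; linarith) ENNReal.ofReal_ne_top,
          eLpNorm_eq_lintegral_rpow_enorm_toReal (by positivity) hpt,
          ENNReal.toReal_ofReal (by linarith)]
        exact hC f
    _ ≤ _ := by
        gcongr
        rw [ENNReal.coe_add, ENNReal.coe_toNNReal hCt]
        exact le_self_add
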